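/- Let $\mathbb D$ be the open unit disc and $\mathbb T$ the unit circle in $\mathbb C$, and let $\mathcal S(\mathbb D^2)$ be the set of analytic functions $h$ on $\mathbb D^2$ with $|h|\le 1$ on $\mathbb D^2$. An algebraic variety $V\subset\mathbb C^2$ (not necessarily irreducible) is called *inner* if $V\cap\mathbb D^2\neq\emptyset$ and $V\cap\partial(\mathbb D^2)\subset\mathbb T^2$. An inner variety $V$ is called a *strong Pick set* for $f\in\mathcal S(\mathbb D^2)$ if every $h\in\mathcal S(\mathbb D^2)$ that equals $f$ on $V\cap\mathbb D^2$ equals $f$ on $\mathbb D^2$. Theorem. Let $d_1,d_2\ge 0$ be integers and let $f(z_1,z_2)=z_1^{d_1}z_2^{d_2}$. Let $p\in\mathbb C[z_1,z_2]$ be a square-free polynomial whose zero set $V=Z_p=\{z\in\mathbb C^2: p(z)=0\}$ is an inner variety, and write $p=m_1+\dots+m_k$, where the $m_j$ are the nonzero monomial terms of $p$, with pairwise distinct exponents. If for each $j$ one has $\deg_1(m_j)>d_1$ or $\deg_2(m_j)>d_2$, where $\deg_i$ denotes the degree in $z_i$, then $V$ is a strong Pick set for $f$. -/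

import Mathlib

/-- The open unit polydisc `𝔻ⁿ` in `ℂⁿ`. -/
def polydisc (n : ℕ) : Set (Fin n → ℂ) := {z | ∀ i, ‖z i‖ < 1}

/-- The unit `n`-torus `𝕋ⁿ` in `ℂⁿ`. -/
def unitTorus (n : ℕ) : Set (Fin n → ℂ) := {z | ∀ i, ‖z i‖ = 1}

/-- The Schur class `𝒮(𝔻ⁿ)`: functions that are analytic on `𝔻ⁿ` and bounded there by `1` in
modulus. Elements are total functions on `ℂⁿ`; only their values on `𝔻ⁿ` matter. -/
def schurClass (n : ℕ) : Set ((Fin n → ℂ) → ℂ) :=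
  {f | AnalyticOnNhd ℂ f (polydisc n) ∧ ∀ z ∈ polydisc n, ‖f z‖ ≤ 1}

/-- The zero set `Z_p` of a polynomial `p` in `ℂⁿ`. -/
def polyZeroSet {n : ℕ} (p : MvPolynomial (Fin n) ℂ) : Set (Fin n → ℂ) :=
  {z | MvPolynomial.eval z p = 0}

/-- An (affine) algebraic variety in `ℂⁿ`: the common zero set of a family of polynomials. -/
def IsAlgebraicVariety {n : ℕ} (V : Set (Fin n → ℂ)) : Prop :=
  ∃ S : Set (MvPolynomial (Fin n) ℂ), V = {z | ∀ q ∈ S, MvPolynomial.eval z q = 0}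

/-- An inner variety: an algebraic variety that meets `𝔻ⁿ` and exits it through the `n`-torus,
that is, meets the topological boundary of `𝔻ⁿ` only in points of `𝕋ⁿ`. Irreducibility is not
required, so that for instance the zero set of `z₁² - z₂²` is an inner variety. -/
structure IsInnerVariety {n : ℕ} (V : Set (Fin n → ℂ)) : Prop where
  isAlgebraic : IsAlgebraicVariety V
  meets : (V ∩ polydisc n).Nonempty
  exits : V ∩ frontier (polydisc n) ⊆ unitTorus n

/-- `V` is a strong Pick set for `f`: here `V` is an inner variety, `f` is in the Schur class, and
every Schur class function that equals `f` on `V ∩ 𝔻ⁿ` equals `f` on `𝔻ⁿ`. -/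
structure IsStrongPickSet {n : ℕ} (V : Set (Fin n → ℂ)) (f : (Fin n → ℂ) → ℂ) : Prop where
  inner : IsInnerVariety V
  schur : f ∈ schurClass n
  unique : ∀ h ∈ schurClass n, Set.EqOn h f (V ∩ polydisc n) → Set.EqOn h f (polydisc n)

/-!
Write `f = z₁^d₁ z₂^d₂`, and let `h` be a Schur class function with `h = f` on `Z_p ∩ 𝔻²`.

Because `p` is square-free, it is coprime to its derivative in either variable over the field of
fractions of the coefficient ring, by Gauss's lemma. Hence all but finitely many slices `p(a, ·)` and
`p(·, b)` have only simple zeros (`exists_slices_fst_simple_roots`,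
`exists_slices_snd_simple_roots`). So there is a torus `|z₁| = r`, `|z₂| = s` in `𝔻²` on which `p` has
no zero and on which every slice has only simple zeros (`exists_torus_eval_ne_zero`). On each such
slice `(h - f) / p` has only removable singularities in the disc, so its product with a
positive power of the variable has mean zero over the circle
(`circleAverage_pow_mul_div_eval_eq_zero`). Expanding
`h - f = ∑ m, p_m z^m (h - f) / p` on the torus and dividing by `z₁^d₁ z₂^d₂`, every summand keeps a
positive power of `z₁` or of `z₂`; averaging in that variable first gives zero. Therefore the Taylor
coefficient of `h - f` at `z₁^d₁ z₂^d₂` vanishes (`exists_torus_torusAverage_div_monomial_eq_zero`),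
that is, the coefficient of `h` there is `1`.

This forces `h = f` (`eqOn_monomial_of_torusAverage_eq_one`): coefficients can be computed on any
torus in `𝔻²`, and on the torus of radius `ρ` the pointwise bound
`|h - f|² ≤ 2 - 2 Re (h * conj f) = 2 - 2 |f|² Re (h / f)` has mean
`2 - 2 ρ^(2 (d₁ + d₂))`. Cauchy's formula for the analytic function `(h - f)²` bounds its value at any
point by a multiple of this mean that stays bounded in `ρ`, and the mean tends to `0` as `ρ` tends to `1`.
-/

/-! ### Square-free polynomials over a domain and over its field of fractions -/

open Polynomial in
/-- A consequence of Gauss's lemma: a square factor over the field of fractions may be replaced by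
the square of a primitive polynomial over the ring, and divisibility by a primitive polynomial
descends. -/
theorem squarefree_map_fractionRing {R K : Type*} [CommRing R] [IsDomain R] [IsGCDMonoid R]
    [Field K] [Algebra R K] [IsFractionRing R K] {P : R[X]} (hP : Squarefree P) :
    Squarefree (P.map (algebraMap R K)) := by
  have : NormalizedGCDMonoid R := Classical.arbitrary _
  have hinj := IsFractionRing.injective R K
  intro g hg
  have hg0 : g ≠ 0 := by
    rintro rfl
    rw [zero_mul, zero_dvd_iff, Polynomial.map_eq_zero_iff hinj] at hg
    exact hP.ne_zero hg
  set N := IsLocalization.integerNormalization (nonZeroDivisors R) g with hN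
  apply isUnit_or_eq_zero_of_isUnit_integerNormalization_primPart (R := R) hg0
  obtain ⟨c, c0, hc⟩ := IsLocalization.integerNormalization_spec (nonZeroDivisors R) g
  have hdvd : N.primPart.map (algebraMap R K) ∣ g := by
    have h1 : N.primPart.map (algebraMap R K) ∣ N.map (algebraMap R K) :=
      Polynomial.map_dvd _ N.primPart_dvd
    have hc0 : IsUnit (C (algebraMap R K c)) := by
      rw [isUnit_C, isUnit_iff_ne_zero]
      exact IsFractionRing.to_map_ne_zero_of_mem_nonZeroDivisors c0
    rw [hN, hc, Algebra.smul_def, Polynomial.algebraMap_apply, hc0.dvd_mul_left] at h1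
    exact h1
  have hprim := N.isPrimitive_primPart.mul N.isPrimitive_primPart
  refine hP _ (hprim.dvd_of_fraction_map_dvd_fraction_map (K := K) ?_)
  rw [Polynomial.map_mul]
  exact (mul_dvd_mul hdvd hdvd).trans hg

open Polynomial in
/-- Separability over the field of fractions, with denominators cleared. -/
theorem exists_mul_add_mul_derivative_eq_C {R : Type*} [CommRing R] [IsDomain R] [IsGCDMonoid R]
    [CharZero R] {P : R[X]} (hP : Squarefree P) :
    ∃ A B : R[X], ∃ r : R, r ≠ 0 ∧ A * P + B * derivative P = C r := by
  have hinj := IsFractionRing.injective R (FractionRing R)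
  have : CharZero (FractionRing R) := charZero_of_injective_algebraMap hinj
  obtain ⟨a, b, hab⟩ := PerfectField.separable_iff_squarefree.2
    (squarefree_map_fractionRing (K := FractionRing R) hP)
  obtain ⟨c, c0, hc⟩ := IsLocalization.integerNormalization_spec (nonZeroDivisors R) a
  obtain ⟨d, d0, hd⟩ := IsLocalization.integerNormalization_spec (nonZeroDivisors R) b
  rw [mem_nonZeroDivisors_iff_ne_zero] at c0 d0
  refine ⟨C d * IsLocalization.integerNormalization (nonZeroDivisors R) a,
    C c * IsLocalization.integerNormalization (nonZeroDivisors R) b, c * d, mul_ne_zero c0 d0, ?_⟩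
  apply Polynomial.map_injective _ hinj
  rw [Algebra.smul_def, Polynomial.algebraMap_apply] at hc hd
  simp only [Polynomial.map_add, Polynomial.map_mul, hc, hd, map_C, ← derivative_map, map_mul]
  linear_combination
    (C (algebraMap R (FractionRing R) c) * C (algebraMap R (FractionRing R) d)) * hab

/-! ### Slices and zero-free tori of a polynomial in two variables -/

open MvPolynomial in
theorem finite_setOf_eval_eq_zero {c : MvPolynomial (Fin 1) ℂ} (hc : c ≠ 0) :
    {b : ℂ | eval (fun _ => b) c = 0}.Finite := by
  have h0 : uniqueAlgEquiv ℂ (Fin 1) c ≠ 0 :=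
    (map_ne_zero_iff _ (uniqueAlgEquiv ℂ (Fin 1)).injective).2 hc
  refine (Polynomial.finite_setOfPred_isRoot h0).subset fun b hb => ?_
  have := eval₂_const_uniqueAlgEquiv (σ := Fin 1) (f := c) (φ := RingHom.id ℂ) (a := b)
  simp only [Set.mem_ofPred_eq, Polynomial.IsRoot.def] at hb ⊢
  rw [← hb, Polynomial.eval, this]; rfl

theorem squarefree_map_mulEquiv {M N : Type*} [CommMonoid M] [CommMonoid N] (e : M ≃* N) {x : M}
    (hx : Squarefree x) : Squarefree (e x) := fun y hy => by
  have h := hx (e.symm y) (by simpa using map_dvd e.symm hy)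
  simpa using h.map e

theorem eval_map_finSuccEquiv (p : MvPolynomial (Fin 2) ℂ) (a b : ℂ) :
    ((MvPolynomial.finSuccEquiv ℂ 1 p).map (MvPolynomial.eval fun _ => b)).eval a =
      MvPolynomial.eval ![a, b] p := by
  rw [← MvPolynomial.eval_eq_eval_mv_eval']
  congr 2
  ext i; fin_cases i <;> rfl

/-- For all but finitely many `b`, the slice `p(·, b)` has only simple roots: if it has a multiple
root, then `b` is a root of a nonzero polynomial in `z₂` alone which lies in the ideal generated by
`p` and `∂p/∂z₁`. The exceptional set contains every `b` whose slice is the zero polynomial. -/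
theorem exists_slices_fst_simple_roots {p : MvPolynomial (Fin 2) ℂ} (hp : Squarefree p) :
    ∃ (P : ℂ → Polynomial ℂ) (S : Set ℂ), S.Finite ∧
      (∀ a b, (P b).eval a = MvPolynomial.eval ![a, b] p) ∧
      ∀ b ∉ S, ∀ a, (P b).eval a = 0 → (P b).derivative.eval a ≠ 0 := by
  have hP : Squarefree (MvPolynomial.finSuccEquiv ℂ 1 p) :=
    squarefree_map_mulEquiv (MvPolynomial.finSuccEquiv ℂ 1).toMulEquiv hp
  obtain ⟨A, B, r, hr, h⟩ := exists_mul_add_mul_derivative_eq_C hP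
  refine ⟨fun b => (MvPolynomial.finSuccEquiv ℂ 1 p).map (MvPolynomial.eval fun _ => b), _,
    finite_setOf_eval_eq_zero hr, fun a b => eval_map_finSuccEquiv p a b,
    fun b hb a h0 h1 => hb ?_⟩
  have := congrArg (fun Q => (Q.map (MvPolynomial.eval fun _ : Fin 1 => b)).eval a) h
  simp only [Polynomial.map_add, Polynomial.map_mul, Polynomial.eval_add, Polynomial.eval_mul, h0,
      Polynomial.map_C, Polynomial.eval_C, ← Polynomial.derivative_map, h1, mul_zero,
      add_zero] at this
  exact this.symm

/-- The counterpart of `exists_slices_fst_simple_roots` for the slices `p(a, ·)`. -/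
theorem exists_slices_snd_simple_roots {p : MvPolynomial (Fin 2) ℂ} (hp : Squarefree p) :
    ∃ (Q : ℂ → Polynomial ℂ) (S : Set ℂ), S.Finite ∧
      (∀ a b, (Q a).eval b = MvPolynomial.eval ![a, b] p) ∧
      ∀ a ∉ S, ∀ b, (Q a).eval b = 0 → (Q a).derivative.eval b ≠ 0 := by
  have hp' : Squarefree (MvPolynomial.rename (Equiv.swap (0 : Fin 2) 1) p) :=
    squarefree_map_mulEquiv (MvPolynomial.renameEquiv ℂ (Equiv.swap (0 : Fin 2) 1)).toMulEquiv hp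
  obtain ⟨Q, S, hS, hQ, hQS⟩ := exists_slices_fst_simple_roots hp'
  refine ⟨Q, S, hS, fun a b => ?_, hQS⟩
  have hswap : ![b, a] ∘ Equiv.swap (0 : Fin 2) 1 = ![a, b] := by
    ext i; fin_cases i <;> simp
  rw [hQ, MvPolynomial.eval_rename, hswap]

theorem exists_mem_Ioo_forall_sphere_notMem {S : Set ℂ} (hS : S.Finite) {δ : ℝ} (hδ : 0 < δ) :
    ∃ r ∈ Set.Ioo 0 δ, ∀ z ∈ Metric.sphere (0 : ℂ) r, z ∉ S := by
  obtain ⟨r, hr, hrS⟩ := (Set.Ioo_infinite hδ).exists_notMem_finite (hS.image norm)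
  exact ⟨r, hr, fun z hz hzS => hrS ⟨z, hzS, by simpa using hz⟩⟩

/-- Divides out the largest power of the first variable, so that the quotient does not vanish
identically on the line where that variable is zero. -/
theorem exists_eval_eq_pow_mul {p : MvPolynomial (Fin 2) ℂ} (hp : p ≠ 0) :
    ∃ (n : ℕ) (q : MvPolynomial (Fin 2) ℂ) (c : MvPolynomial (Fin 1) ℂ), c ≠ 0 ∧
      (∀ a b, MvPolynomial.eval ![a, b] p = a ^ n * MvPolynomial.eval ![a, b] q) ∧
      ∀ b, MvPolynomial.eval ![0, b] q = MvPolynomial.eval (fun _ => b) c := by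
  have hP : MvPolynomial.finSuccEquiv ℂ 1 p ≠ 0 := by simpa using hp
  obtain ⟨Q, hQ, hdvd⟩ := Polynomial.exists_eq_pow_rootMultiplicity_mul_and_not_dvd _ hP 0
  rw [Polynomial.dvd_iff_isRoot, Polynomial.IsRoot.def] at hdvd
  obtain ⟨q, rfl⟩ := (MvPolynomial.finSuccEquiv ℂ 1).surjective Q
  generalize Polynomial.rootMultiplicity 0 (MvPolynomial.finSuccEquiv ℂ 1 p) = n at hQ
  refine ⟨n, q, (MvPolynomial.finSuccEquiv ℂ 1 q).eval 0, hdvd, fun a b => ?_, fun b => ?_⟩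
  · rw [← eval_map_finSuccEquiv p, hQ, ← eval_map_finSuccEquiv q]
    simp only [Polynomial.map_mul, Polynomial.map_pow, Polynomial.eval_mul, Polynomial.eval_pow,
      map_zero, sub_zero, Polynomial.map_X, Polynomial.eval_X]
  · rw [← eval_map_finSuccEquiv q, Polynomial.eval_map, Polynomial.eval₂_at_zero,
      Polynomial.coeff_zero_eq_eval_zero]

theorem exists_forall_norm_lt_ne_zero {g : ℂ × ℂ → ℂ} (hg : Continuous g) {K : Set ℂ}
    (hK : IsCompact K) (h0 : ∀ b ∈ K, g (0, b) ≠ 0) :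
    ∃ δ > 0, ∀ a, ‖a‖ < δ → ∀ b ∈ K, g (a, b) ≠ 0 := by
  have hsub : {(0 : ℂ)} ×ˢ K ⊆ {x : ℂ × ℂ | g x ≠ 0} := by
    rintro ⟨a, b⟩ ⟨rfl, hb⟩
    exact h0 b hb
  obtain ⟨u, v, hu, -, h0u, hKv, huv⟩ := generalized_tube_lemma isCompact_singleton
    hK (isOpen_ne_fun hg continuous_const) hsub
  obtain ⟨δ, hδ, hδu⟩ := Metric.isOpen_iff.1 hu 0 (by simpa using h0u)
  exact ⟨δ, hδ, fun a ha b hb => huv (Set.mk_mem_prod (hδu (by simpa using ha)) (hKv hb))⟩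

/-- With `p = z₁^n q` and `q(0, ·)` not identically zero, choose the second radius `s` so that
`q(0, ·)` has no zero on the circle, and then the first radius `r` small. -/
theorem exists_torus_eval_ne_zero {p : MvPolynomial (Fin 2) ℂ} (hp : p ≠ 0) {S₀ S₁ : Set ℂ}
    (hS₀ : S₀.Finite) (hS₁ : S₁.Finite) :
    ∃ r s : ℝ, r ∈ Set.Ioo (0 : ℝ) 1 ∧ s ∈ Set.Ioo (0 : ℝ) 1 ∧
      (∀ a ∈ Metric.sphere (0 : ℂ) r, a ∉ S₀) ∧ (∀ b ∈ Metric.sphere (0 : ℂ) s, b ∉ S₁) ∧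
      ∀ a ∈ Metric.sphere (0 : ℂ) r, ∀ b ∈ Metric.sphere (0 : ℂ) s,
        MvPolynomial.eval ![a, b] p ≠ 0 := by
  obtain ⟨n, q, c, hc, hpq, hq0⟩ := exists_eval_eq_pow_mul hp
  obtain ⟨s, hs, hsS⟩ := exists_mem_Ioo_forall_sphere_notMem
    (hS₁.union (finite_setOf_eval_eq_zero hc)) one_pos
  have hcont : Continuous fun x : ℂ × ℂ => MvPolynomial.eval ![x.1, x.2] q :=
    (MvPolynomial.continuous_eval q).comp (by fun_prop)
  obtain ⟨δ, hδ, hδq⟩ := exists_forall_norm_lt_ne_zero hcont (isCompact_sphere (0 : ℂ) s)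
    fun b hb h => hsS b hb (Or.inr ((hq0 b).symm.trans h))
  obtain ⟨r, hr, hrS⟩ := exists_mem_Ioo_forall_sphere_notMem hS₀ (lt_min hδ one_pos)
  refine ⟨r, s, ⟨hr.1, hr.2.trans_le (min_le_right _ _)⟩, hs, hrS,
    fun b hb h => hsS b hb (Or.inl h), fun a ha b hb => ?_⟩
  have har : ‖a‖ = r := by simpa using ha
  rw [hpq]
  refine mul_ne_zero (pow_ne_zero _ ?_)
    (hδq a (har.trans_lt (hr.2.trans_le (min_le_left _ _))) b hb)
  rw [← norm_ne_zero_iff, har]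
  exact hr.1.ne'

/-! ### Averages over circles -/

open Complex Real Metric Set Filter Topology in
/-- If `g` vanishes at the zeros of `P` and these are simple, then `g / P` has only removable
singularities, and `z ^ k * (g / P)` has mean equal to its value `0` at the origin. -/
theorem circleAverage_pow_mul_div_eval_eq_zero {P : Polynomial ℂ} {g : ℂ → ℂ} {r : ℝ}
    (hr : r ∈ Ioo (0 : ℝ) 1) (hg : DifferentiableOn ℂ g (ball 0 1))
    (hP : ∀ z ∈ sphere (0 : ℂ) r, P.eval z ≠ 0)
    (hsimple : ∀ z, P.eval z = 0 → P.derivative.eval z ≠ 0)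
    (hzero : ∀ z ∈ ball (0 : ℂ) 1, P.eval z = 0 → g z = 0) {k : ℕ} (hk : k ≠ 0) :
    circleAverage (fun z => z ^ k * (g z / P.eval z)) 0 r = 0 := by
  have hr' : |r| = r := abs_of_pos hr.1
  have hP0 : P ≠ 0 := by
    rintro rfl
    exact hP r (by simp [hr']) (by simp)
  -- The continuous extension of `g / P`, with the value given by l'Hôpital's rule at the zeros.
  set q : ℂ → ℂ := fun z =>
    if P.eval z = 0 then deriv g z / P.derivative.eval z else g z / P.eval z with hq
  have hqP {z : ℂ} (hz : P.eval z ≠ 0) : q z = g z / P.eval z := if_neg hz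
  have hgz {z : ℂ} (hz : z ∈ ball (0 : ℂ) 1) : DifferentiableAt ℂ g z :=
    hg.differentiableAt (isOpen_ball.mem_nhds hz)
  have hdiff {z : ℂ} (hz : z ∈ ball (0 : ℂ) 1) (hPz : P.eval z ≠ 0) : DifferentiableAt ℂ q z := by
    refine ((hgz hz).div P.differentiableAt hPz).congr_of_eventuallyEq ?_
    filter_upwards [P.continuous.continuousAt.eventually_ne hPz] with w hw using hqP hw
  have hcont {z : ℂ} (hz : z ∈ ball (0 : ℂ) 1) : ContinuousAt q z := by
    by_cases hPz : P.eval z = 0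
    · rw [← continuousWithinAt_compl_self, ContinuousWithinAt]
      have hq0 : q z = deriv g z / P.derivative.eval z := if_pos hPz
      rw [hq0]
      refine ((hasDerivAt_iff_tendsto_slope.1 (hgz hz).hasDerivAt).div
        (hasDerivAt_iff_tendsto_slope.1 (P.hasDerivAt z)) (hsimple z hPz)).congr' ?_
      filter_upwards [(P.hasDerivAt z).eventually_ne (hsimple z hPz), self_mem_nhdsWithin]
        with w hw hwz
      rw [hqP hw, Pi.div_apply, slope_def_field, slope_def_field, hPz, hzero z hz hPz,
        sub_zero, sub_zero, div_div_div_cancel_right₀ (sub_ne_zero.2 hwz)]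
    · exact (hdiff hz hPz).continuousAt
  have hcongr : EqOn (fun z => z ^ k * (g z / P.eval z)) (fun z => z ^ k * q z) (sphere 0 |r|) :=
    fun z hz => by simp only [hqP (hP z (by rwa [hr'] at hz))]
  have hball : closedBall (0 : ℂ) |r| ⊆ ball 0 1 := closedBall_subset_ball (by rw [hr']; exact hr.2)
  rw [circleAverage_congr_sphere hcongr, circleAverage_of_differentiable_on_off_countable
    (f := fun z => z ^ k * q z) (s := {z | P.IsRoot z})
    (Polynomial.finite_setOfPred_isRoot hP0).countable
    (fun z hz => ((by fun_prop : ContinuousAt (fun z : ℂ => z ^ k) z).mul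
      (hcont (hball hz))).continuousWithinAt)
    fun z hz => ((differentiableAt_id.pow k).mul
      (hdiff (hball (ball_subset_closedBall hz.1)) hz.2))]
  simp [hk]

open Complex Real Metric Set in
theorem circleAverage_div_pow_eq_of_le {g : ℂ → ℂ} {r s : ℝ} (hr : 0 < r) (hrs : r ≤ s)
    (hs : s < 1) (hg : DifferentiableOn ℂ g (ball 0 1)) (d : ℕ) :
    circleAverage (fun z => g z / z ^ d) 0 s = circleAverage (fun z => g z / z ^ d) 0 r := by
  rw [circleAverage_eq_circleIntegral hr.ne', circleAverage_eq_circleIntegral (hr.trans_le hrs).ne']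
  congr 1
  have hd : ∀ z ∈ closedBall (0 : ℂ) s \ ball 0 r,
      DifferentiableAt ℂ (fun z => (z - 0)⁻¹ • (g z / z ^ d)) z := by
    intro z hz
    have hz0 : z ≠ 0 := by
      rintro rfl
      exact hz.2 (mem_ball_self hr)
    have hgz := hg.differentiableAt (isOpen_ball.mem_nhds (closedBall_subset_ball hs hz.1))
    have : z - 0 ≠ 0 := by simpa using hz0
    have := pow_ne_zero d hz0
    fun_prop (disch := assumption)
  refine circleIntegral_eq_of_differentiable_on_annulus_off_countable hr hrs countable_empty
    (fun z hz => (hd z hz).continuousAt.continuousWithinAt) fun z hz => hd z ?_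
  exact ⟨ball_subset_closedBall hz.1.1, fun h => hz.1.2 (ball_subset_closedBall h)⟩

open Complex Real Metric Set in
theorem circleAverage_div_pow_eq {g : ℂ → ℂ} {r s : ℝ} (hr : r ∈ Ioo (0 : ℝ) 1)
    (hs : s ∈ Ioo (0 : ℝ) 1) (hg : DifferentiableOn ℂ g (ball 0 1)) (d : ℕ) :
    circleAverage (fun z => g z / z ^ d) 0 r = circleAverage (fun z => g z / z ^ d) 0 s := by
  rcases le_total r s with h | h
  · exact (circleAverage_div_pow_eq_of_le hr.1 h hs.2 hg d).symm
  · exact circleAverage_div_pow_eq_of_le hs.1 h hr.2 hg d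

open Complex Real Metric Set in
/-- A complex majorant `G` is used so that all means stay complex valued. No integrability of `F` is
needed, the mean being `0` otherwise. -/
theorem norm_circleAverage_le_re {F G : ℂ → ℂ} {c : ℂ} {r : ℝ} (hG : CircleIntegrable G c r)
    (h : ∀ z ∈ sphere c |r|, ‖F z‖ ≤ (G z).re) :
    ‖circleAverage F c r‖ ≤ (circleAverage G c r).re := by
  have hint : IntervalIntegrable (fun θ => (G (circleMap c r θ)).re)
      MeasureTheory.volume 0 (2 * π) :=
    ⟨hG.1.re, hG.2.re⟩
  rw [circleAverage, circleAverage, norm_smul, Complex.smul_re, smul_eq_mul,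
    Real.norm_of_nonneg (by positivity)]
  refine mul_le_mul_of_nonneg_left ?_ (by positivity)
  refine (intervalIntegral.norm_integral_le_of_norm_le two_pi_pos.le
    (Filter.Eventually.of_forall fun θ _ => h _ (circleMap_mem_sphere' c r θ)) hint).trans_eq ?_
  exact reCLM.intervalIntegral_comp_comm hG

/-! ### Averages over tori -/

/-- The mean of `F` over the torus `|z₁| = r`, `|z₂| = s`, as an iterated circle average with the
second variable innermost. Taylor coefficients at the origin are encoded as the means of
`h x / (x.1 ^ d * x.2 ^ e)`. -/
noncomputable def torusAverage (F : ℂ × ℂ → ℂ) (r s : ℝ) : ℂ :=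
  Real.circleAverage (fun a => Real.circleAverage (fun b => F (a, b)) 0 s) 0 r

section torusAverage

open Complex Real Metric Set

variable {F G : ℂ × ℂ → ℂ} {r s : ℝ}

theorem continuous_comp_circleMap (hF : ContinuousOn F (sphere 0 |r| ×ˢ sphere 0 |s|)) :
    Continuous fun x : ℝ × ℝ => F (circleMap 0 r x.1, circleMap 0 s x.2) :=
  hF.comp_continuous (by fun_prop) fun x =>
    ⟨circleMap_mem_sphere' 0 r x.1, circleMap_mem_sphere' 0 s x.2⟩

theorem circleIntegrable_right (hF : ContinuousOn F (sphere 0 |r| ×ˢ sphere 0 |s|)) {a : ℂ}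
    (ha : a ∈ sphere 0 |r|) : CircleIntegrable (fun b => F (a, b)) 0 s :=
  ContinuousOn.circleIntegrable' (hF.comp (by fun_prop) fun _ hb => ⟨ha, hb⟩)

theorem circleIntegrable_circleAverage (hF : ContinuousOn F (sphere 0 |r| ×ˢ sphere 0 |s|)) :
    CircleIntegrable (fun a => circleAverage (fun b => F (a, b)) 0 s) 0 r := by
  refine Continuous.intervalIntegrable (Continuous.const_smul ?_ _) _ _
  exact intervalIntegral.continuous_parametric_intervalIntegral_of_continuous'
    (continuous_comp_circleMap hF) 0 (2 * π)

theorem torusAverage_congr (h : EqOn F G (sphere 0 |r| ×ˢ sphere 0 |s|)) :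
    torusAverage F r s = torusAverage G r s :=
  circleAverage_congr_sphere fun _ ha => circleAverage_congr_sphere fun _ hb => h ⟨ha, hb⟩

theorem torusAverage_swap (hF : ContinuousOn F (sphere 0 |r| ×ˢ sphere 0 |s|)) :
    torusAverage F r s = circleAverage (fun b => circleAverage (fun a => F (a, b)) 0 r) 0 s := by
  simp only [torusAverage, circleAverage, intervalIntegral.integral_smul]
  congr 2
  refine MeasureTheory.intervalIntegral_intervalIntegral_swap
    (F := fun θ φ => F (circleMap 0 r θ, circleMap 0 s φ)) ?_
  exact ((continuous_comp_circleMap hF).continuousOn.integrableOn_compact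
    (isCompact_uIcc.prod isCompact_uIcc)).mono_set (prod_mono uIoc_subset_uIcc uIoc_subset_uIcc)

theorem torusAverage_sub (hF : ContinuousOn F (sphere 0 |r| ×ˢ sphere 0 |s|))
    (hG : ContinuousOn G (sphere 0 |r| ×ˢ sphere 0 |s|)) :
    torusAverage (fun x => F x - G x) r s = torusAverage F r s - torusAverage G r s := by
  rw [torusAverage, torusAverage, torusAverage, ← circleAverage_fun_sub
    (circleIntegrable_circleAverage hF) (circleIntegrable_circleAverage hG)]
  exact circleAverage_congr_sphere fun a ha => circleAverage_fun_sub
    (circleIntegrable_right hF ha) (circleIntegrable_right hG ha)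

theorem torusAverage_sum {ι : Type*} {t : Finset ι} {F : ι → ℂ × ℂ → ℂ}
    (hF : ∀ i ∈ t, ContinuousOn (F i) (sphere 0 |r| ×ˢ sphere 0 |s|)) :
    torusAverage (fun x => ∑ i ∈ t, F i x) r s = ∑ i ∈ t, torusAverage (F i) r s := by
  simp only [torusAverage]
  rw [← circleAverage_fun_sum fun i hi => circleIntegrable_circleAverage (hF i hi)]
  exact circleAverage_congr_sphere fun a ha => circleAverage_fun_sum
    fun i hi => circleIntegrable_right (hF i hi) ha

theorem torusAverage_const_mul (c : ℂ) :
    torusAverage (fun x => c * F x) r s = c * torusAverage F r s := by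
  simp only [torusAverage, ← smul_eq_mul, circleAverage_fun_smul]

theorem torusAverage_const (c : ℂ) : torusAverage (fun _ => c) r s = c := by
  simp only [torusAverage, circleAverage_const]

theorem norm_torusAverage_le_re (hG : ContinuousOn G (sphere 0 |r| ×ˢ sphere 0 |s|))
    (h : ∀ x ∈ sphere (0 : ℂ) |r| ×ˢ sphere (0 : ℂ) |s|, ‖F x‖ ≤ (G x).re) :
    ‖torusAverage F r s‖ ≤ (torusAverage G r s).re :=
  norm_circleAverage_le_re (circleIntegrable_circleAverage hG) fun a ha =>
    norm_circleAverage_le_re (circleIntegrable_right hG ha) fun b hb => h (a, b) ⟨ha, hb⟩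

end torusAverage

/-! ### Coefficients and extremality on the bidisc -/

section bidisc

open Complex Real Metric Set

variable {h : ℂ × ℂ → ℂ}

theorem sphere_prod_subset_bidisc {r s : ℝ} (hr : r ∈ Ioo (0 : ℝ) 1) (hs : s ∈ Ioo (0 : ℝ) 1) :
    sphere (0 : ℂ) |r| ×ˢ sphere (0 : ℂ) |s| ⊆ ball 0 1 ×ˢ ball 0 1 :=
  prod_mono (sphere_subset_ball (by rw [abs_of_pos hr.1]; exact hr.2))
    (sphere_subset_ball (by rw [abs_of_pos hs.1]; exact hs.2))

theorem ne_zero_of_mem_sphere_abs {r : ℝ} (hr : 0 < r) {a : ℂ} (ha : a ∈ sphere (0 : ℂ) |r|) :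
    a ≠ 0 :=
  ne_zero_of_mem_sphere (abs_pos.2 hr.ne').ne' ⟨a, ha⟩

theorem differentiableOn_fst_slice (hh : DifferentiableOn ℂ h (ball 0 1 ×ˢ ball 0 1)) {b : ℂ}
    (hb : b ∈ ball (0 : ℂ) 1) : DifferentiableOn ℂ (fun a => h (a, b)) (ball 0 1) :=
  hh.comp (by fun_prop) fun _ ha => ⟨ha, hb⟩

theorem differentiableOn_snd_slice (hh : DifferentiableOn ℂ h (ball 0 1 ×ˢ ball 0 1)) {a : ℂ}
    (ha : a ∈ ball (0 : ℂ) 1) : DifferentiableOn ℂ (fun b => h (a, b)) (ball 0 1) :=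
  hh.comp (by fun_prop) fun _ hb => ⟨ha, hb⟩

theorem continuousOn_div_monomial {r s : ℝ} (hr : 0 < r) (hs : 0 < s)
    (hh : ContinuousOn h (sphere 0 |r| ×ˢ sphere 0 |s|)) (d e : ℕ) :
    ContinuousOn (fun x => h x / (x.1 ^ d * x.2 ^ e)) (sphere 0 |r| ×ˢ sphere 0 |s|) :=
  hh.div (by fun_prop) fun _ hx => mul_ne_zero
    (pow_ne_zero _ (ne_zero_of_mem_sphere_abs hr hx.1))
    (pow_ne_zero _ (ne_zero_of_mem_sphere_abs hs hx.2))

/-- Taylor coefficients may be computed on any torus in the bidisc centred at the origin. -/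
theorem torusAverage_div_monomial_eq (hh : DifferentiableOn ℂ h (ball 0 1 ×ˢ ball 0 1))
    {r s r' s' : ℝ} (hr : r ∈ Ioo (0 : ℝ) 1) (hs : s ∈ Ioo (0 : ℝ) 1) (hr' : r' ∈ Ioo (0 : ℝ) 1)
    (hs' : s' ∈ Ioo (0 : ℝ) 1) (d e : ℕ) :
    torusAverage (fun x => h x / (x.1 ^ d * x.2 ^ e)) r s =
      torusAverage (fun x => h x / (x.1 ^ d * x.2 ^ e)) r' s' := by
  have hcont {r s : ℝ} (hr : r ∈ Ioo (0 : ℝ) 1) (hs : s ∈ Ioo (0 : ℝ) 1) :=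
    continuousOn_div_monomial hr.1 hs.1
      (hh.continuousOn.mono (sphere_prod_subset_bidisc hr hs)) d e
  trans torusAverage (fun x => h x / (x.1 ^ d * x.2 ^ e)) r s'
  · refine circleAverage_congr_sphere fun a ha => ?_
    have ha' : a ∈ ball (0 : ℂ) 1 :=
      sphere_subset_ball (by rw [abs_of_pos hr.1]; exact hr.2) ha
    simp only [div_mul_eq_div_div_swap _ (a ^ d), div_eq_inv_mul _ (a ^ d), ← smul_eq_mul (a ^ d)⁻¹,
      circleAverage_fun_smul]
    rw [circleAverage_div_pow_eq hs hs' (differentiableOn_snd_slice hh ha')]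
  · rw [torusAverage_swap (hcont hr hs'), torusAverage_swap (hcont hr' hs')]
    refine circleAverage_congr_sphere fun b hb => ?_
    have hb' : b ∈ ball (0 : ℂ) 1 :=
      sphere_subset_ball (by rw [abs_of_pos hs'.1]; exact hs'.2) hb
    simp only [div_mul_eq_div_div, div_eq_inv_mul _ (b ^ e), ← smul_eq_mul (b ^ e)⁻¹,
      circleAverage_fun_smul]
    rw [circleAverage_div_pow_eq hr hr' (differentiableOn_fst_slice hh hb')]

/-- Cauchy's integral formula on the bidisc. -/
theorem torusAverage_cauchy_kernel_mul (hh : DifferentiableOn ℂ h (ball 0 1 ×ˢ ball 0 1)) {r s : ℝ}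
    (hr : r ∈ Ioo (0 : ℝ) 1) (hs : s ∈ Ioo (0 : ℝ) 1) {z : ℂ × ℂ} (hz₁ : ‖z.1‖ < r)
    (hz₂ : ‖z.2‖ < s) :
    torusAverage (fun x => x.1 / (x.1 - z.1) * (x.2 / (x.2 - z.2)) * h x) r s = h z := by
  have key {g : ℂ → ℂ} {r : ℝ} (hr : r ∈ Ioo (0 : ℝ) 1) (hg : DifferentiableOn ℂ g (ball 0 1))
      {w : ℂ} (hw : ‖w‖ < r) : circleAverage (fun a => a / (a - w) * g a) 0 r = g w := by
    have h1 : DiffContOnCl ℂ g (ball 0 |r|) := by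
      refine (hg.mono ?_).diffContOnCl
      exact closure_ball_subset_closedBall.trans
        (closedBall_subset_ball (by rw [abs_of_pos hr.1]; exact hr.2))
    simpa only [sub_zero, smul_eq_mul] using
      h1.circleAverage_smul_div (w := w) (by simpa [abs_of_pos hr.1] using hw)
  rw [torusAverage, ← key hr (differentiableOn_fst_slice hh (b := z.2)
    (by simpa using hz₂.trans hs.2)) hz₁]
  refine circleAverage_congr_sphere fun a ha => ?_
  have ha' : a ∈ ball (0 : ℂ) 1 := sphere_subset_ball (by rw [abs_of_pos hr.1]; exact hr.2) ha
  rw [← key hs (differentiableOn_snd_slice hh ha') hz₂]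
  simp only [mul_assoc]
  exact circleAverage_fun_smul (a := a / (a - z.1))
    (f := fun b => b / (b - z.2) * h (a, b))

theorem norm_sub_sq_le_two_sub {u w : ℂ} (hw0 : w ≠ 0) (hu : ‖u‖ ≤ 1) (hw : ‖w‖ ≤ 1) :
    ‖u - w‖ ^ 2 ≤ 2 - 2 * ‖w‖ ^ 2 * (u / w).re := by
  have h1 : ‖w‖ ^ 2 * (u / w).re = (u * (starRingEnd ℂ) w).re := by
    rw [Complex.sq_norm, ← re_ofReal_mul, ← mul_conj]
    congr 1
    field_simp
  have h2 : ‖u - w‖ ^ 2 = ‖u‖ ^ 2 + ‖w‖ ^ 2 - 2 * (u * (starRingEnd ℂ) w).re := by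
    simp only [Complex.sq_norm, normSq_sub]
  nlinarith [norm_nonneg u, norm_nonneg w]

theorem norm_div_sub_le {r : ℝ} {a z : ℂ} (ha : ‖a‖ = r) (hz : ‖z‖ < r) :
    ‖a / (a - z)‖ ≤ r / (r - ‖z‖) := by
  rw [norm_div, ha]
  have := norm_sub_norm_le a z
  rw [ha] at this
  exact div_le_div_of_nonneg_left ((norm_nonneg z).trans hz.le) (sub_pos.2 hz) this

/-- Cauchy's formula for `(h - f)²`, with `f` the monomial, combined with the pointwise bound
`|h - f|² ≤ 2 - 2 |f|² Re (h / f)` on the torus. -/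
theorem norm_sub_monomial_sq_le (hh : DifferentiableOn ℂ h (ball 0 1 ×ˢ ball 0 1))
    (hh1 : ∀ x ∈ ball (0 : ℂ) 1 ×ˢ ball (0 : ℂ) 1, ‖h x‖ ≤ 1) (d e : ℕ) {ρ : ℝ}
    (hρ : ρ ∈ Ioo (0 : ℝ) 1) (hcoeff : torusAverage (fun x => h x / (x.1 ^ d * x.2 ^ e)) ρ ρ = 1)
    {z : ℂ × ℂ} (hz₁ : ‖z.1‖ < ρ) (hz₂ : ‖z.2‖ < ρ) :
    ‖h z - z.1 ^ d * z.2 ^ e‖ ^ 2 ≤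
      ρ / (ρ - ‖z.1‖) * (ρ / (ρ - ‖z.2‖)) * (2 - 2 * (ρ ^ d * ρ ^ e) ^ 2) := by
  set K : ℝ := ρ / (ρ - ‖z.1‖) * (ρ / (ρ - ‖z.2‖))
  have hρ' : |ρ| = ρ := abs_of_pos hρ.1
  have hsub := sphere_prod_subset_bidisc hρ hρ
  have hcont := continuousOn_div_monomial hρ.1 hρ.1 (hh.continuousOn.mono hsub) d e
  have hdiff : DifferentiableOn ℂ (fun x : ℂ × ℂ => (h x - x.1 ^ d * x.2 ^ e) ^ 2)
      (ball 0 1 ×ˢ ball 0 1) := by fun_prop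
  have hG : torusAverage (fun x => (K : ℂ) * ((2 : ℂ) -
      (2 * (ρ ^ d * ρ ^ e) ^ 2 : ℝ) * (h x / (x.1 ^ d * x.2 ^ e)))) ρ ρ =
      ((K * (2 - 2 * (ρ ^ d * ρ ^ e) ^ 2) : ℝ) : ℂ) := by
    rw [torusAverage_const_mul, torusAverage_sub continuousOn_const (by fun_prop),
      torusAverage_const, torusAverage_const_mul, hcoeff]
    push_cast
    ring
  have hle := norm_torusAverage_le_re (r := ρ) (s := ρ)
    (F := fun x => x.1 / (x.1 - z.1) * (x.2 / (x.2 - z.2)) * (h x - x.1 ^ d * x.2 ^ e) ^ 2)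
    (G := fun x => (K : ℂ) * ((2 : ℂ) -
      (2 * (ρ ^ d * ρ ^ e) ^ 2 : ℝ) * (h x / (x.1 ^ d * x.2 ^ e))))
    (by fun_prop) ?_
  · rwa [torusAverage_cauchy_kernel_mul hdiff hρ hρ hz₁ hz₂, hG, ofReal_re, norm_pow] at hle
  · rintro ⟨a, b⟩ hx
    have ha : ‖a‖ = ρ := by simpa [hρ'] using hx.1
    have hb : ‖b‖ = ρ := by simpa [hρ'] using hx.2
    have ha0 : a ≠ 0 := ne_zero_of_mem_sphere_abs hρ.1 hx.1
    have hb0 : b ≠ 0 := ne_zero_of_mem_sphere_abs hρ.1 hx.2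
    have hw : ‖a ^ d * b ^ e‖ = ρ ^ d * ρ ^ e := by simp [ha, hb]
    have h1 := norm_sub_sq_le_two_sub (mul_ne_zero (pow_ne_zero d ha0) (pow_ne_zero e hb0))
      (hh1 _ (hsub hx)) (hw.trans_le (mul_le_one₀ (pow_le_one₀ hρ.1.le hρ.2.le)
        (pow_nonneg hρ.1.le _) (pow_le_one₀ hρ.1.le hρ.2.le)))
    rw [hw] at h1
    rw [re_ofReal_mul, sub_re, re_ofReal_mul, norm_mul, norm_mul, norm_pow]
    refine mul_le_mul (mul_le_mul (norm_div_sub_le ha hz₁) (norm_div_sub_le hb hz₂) (norm_nonneg _)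
      (div_nonneg hρ.1.le (sub_nonneg.2 hz₁.le))) h1 (by positivity)
      (mul_nonneg (div_nonneg hρ.1.le (sub_nonneg.2 hz₁.le))
        (div_nonneg hρ.1.le (sub_nonneg.2 hz₂.le)))

open Filter Topology in
/-- A Schur class function on the bidisc with a Taylor coefficient equal to `1` is the corresponding
monomial. -/
theorem eqOn_monomial_of_torusAverage_eq_one (hh : DifferentiableOn ℂ h (ball 0 1 ×ˢ ball 0 1))
    (hh1 : ∀ x ∈ ball (0 : ℂ) 1 ×ˢ ball (0 : ℂ) 1, ‖h x‖ ≤ 1) {d e : ℕ} {r s : ℝ}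
    (hr : r ∈ Ioo (0 : ℝ) 1) (hs : s ∈ Ioo (0 : ℝ) 1)
    (hcoeff : torusAverage (fun x => h x / (x.1 ^ d * x.2 ^ e)) r s = 1) :
    EqOn h (fun x => x.1 ^ d * x.2 ^ e) (ball 0 1 ×ˢ ball 0 1) := by
  intro z hz
  have hz₁ : ‖z.1‖ < 1 := by simpa using hz.1
  have hz₂ : ‖z.2‖ < 1 := by simpa using hz.2
  have hlim : Tendsto (fun ρ : ℝ =>
      ρ / (ρ - ‖z.1‖) * (ρ / (ρ - ‖z.2‖)) * (2 - 2 * (ρ ^ d * ρ ^ e) ^ 2)) (𝓝[<] 1) (𝓝 0) := by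
    have h₁ : 1 - ‖z.1‖ ≠ 0 := (sub_pos.2 hz₁).ne'
    have h₂ : 1 - ‖z.2‖ ≠ 0 := (sub_pos.2 hz₂).ne'
    have : ContinuousAt (fun ρ : ℝ =>
        ρ / (ρ - ‖z.1‖) * (ρ / (ρ - ‖z.2‖)) * (2 - 2 * (ρ ^ d * ρ ^ e) ^ 2)) 1 := by
      fun_prop (disch := assumption)
    simpa using this.tendsto.mono_left nhdsWithin_le_nhds
  have hle : ‖h z - z.1 ^ d * z.2 ^ e‖ ^ 2 ≤ 0 := by
    refine ge_of_tendsto hlim ?_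
    filter_upwards [Ioo_mem_nhdsLT (max_lt hz₁ hz₂)] with ρ hρ
    have hρ0 : ρ ∈ Ioo (0 : ℝ) 1 := ⟨((norm_nonneg _).trans (le_max_left _ _)).trans_lt hρ.1, hρ.2⟩
    exact norm_sub_monomial_sq_le hh hh1 d e hρ0
      ((torusAverage_div_monomial_eq hh hρ0 hρ0 hr hs d e).trans hcoeff)
      ((le_max_left _ _).trans_lt hρ.1) ((le_max_right _ _).trans_lt hρ.1)
  rw [← sub_eq_zero, ← norm_eq_zero]
  exact pow_eq_zero_iff two_ne_zero |>.1 (le_antisymm hle (sq_nonneg _))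

end bidisc

/-! ### Vanishing of a coefficient for functions vanishing on the zero set -/

section vanishing

open Complex Real Metric Set

/-- A function vanishing on the zero set of `p` has vanishing Taylor coefficient at `z₁^d z₂^e` when
every monomial of `p` has degree above `d` in `z₁` or above `e` in `z₂`. The same torus
serves for every such function. -/
theorem exists_torus_torusAverage_div_monomial_eq_zero {p : MvPolynomial (Fin 2) ℂ}
    (hp : Squarefree p) {d e : ℕ} (hdeg : ∀ m ∈ p.support, d < m 0 ∨ e < m 1) :
    ∃ r s : ℝ, r ∈ Ioo (0 : ℝ) 1 ∧ s ∈ Ioo (0 : ℝ) 1 ∧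
      ∀ F : ℂ × ℂ → ℂ, DifferentiableOn ℂ F (ball 0 1 ×ˢ ball 0 1) →
        (∀ x ∈ ball (0 : ℂ) 1 ×ˢ ball (0 : ℂ) 1, MvPolynomial.eval ![x.1, x.2] p = 0 → F x = 0) →
        torusAverage (fun x => F x / (x.1 ^ d * x.2 ^ e)) r s = 0 := by
  obtain ⟨P, S₁, hS₁, hP, hPS⟩ := exists_slices_fst_simple_roots hp
  obtain ⟨Q, S₀, hS₀, hQ, hQS⟩ := exists_slices_snd_simple_roots hp
  obtain ⟨r, s, hr, hs, hrS, hsS, hpT⟩ := exists_torus_eval_ne_zero hp.ne_zero hS₀ hS₁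
  refine ⟨r, s, hr, hs, fun F hF hF0 => ?_⟩
  have hr' : |r| = r := abs_of_pos hr.1
  have hs' : |s| = s := abs_of_pos hs.1
  have hsub := sphere_prod_subset_bidisc hr hs
  have hpT' : ∀ x ∈ sphere (0 : ℂ) |r| ×ˢ sphere (0 : ℂ) |s|,
      MvPolynomial.eval ![x.1, x.2] p ≠ 0 := by
    rw [hr', hs']
    exact fun x hx => hpT _ hx.1 _ hx.2
  have hpcont : Continuous fun x : ℂ × ℂ => MvPolynomial.eval ![x.1, x.2] p :=
    (MvPolynomial.continuous_eval p).comp (by fun_prop)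
  have hq : ContinuousOn (fun x => F x / MvPolynomial.eval ![x.1, x.2] p)
      (sphere 0 |r| ×ˢ sphere 0 |s|) :=
    (hF.continuousOn.mono hsub).div hpcont.continuousOn hpT'
  have hterm (m : Fin 2 →₀ ℕ) : ContinuousOn (fun x : ℂ × ℂ => p.coeff m * (x.1 ^ m 0 * x.2 ^ m 1 *
      (F x / MvPolynomial.eval ![x.1, x.2] p) / (x.1 ^ d * x.2 ^ e)))
      (sphere 0 |r| ×ˢ sphere 0 |s|) :=
    continuousOn_const.mul (continuousOn_div_monomial hr.1 hs.1 (by fun_prop) d e)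
  have hsplit : EqOn (fun x => F x / (x.1 ^ d * x.2 ^ e))
      (fun x => ∑ m ∈ p.support, p.coeff m * (x.1 ^ m 0 * x.2 ^ m 1 *
        (F x / MvPolynomial.eval ![x.1, x.2] p) / (x.1 ^ d * x.2 ^ e)))
      (sphere 0 |r| ×ˢ sphere 0 |s|) := by
    intro x hx
    have hpx : MvPolynomial.eval ![x.1, x.2] p =
        ∑ m ∈ p.support, p.coeff m * (x.1 ^ m 0 * x.2 ^ m 1) := by
      simp [MvPolynomial.eval_eq', Fin.prod_univ_two]
    have hne := hpT' x hx
    calc F x / (x.1 ^ d * x.2 ^ e)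
        = MvPolynomial.eval ![x.1, x.2] p * (F x / MvPolynomial.eval ![x.1, x.2] p) /
            (x.1 ^ d * x.2 ^ e) := by rw [mul_div_cancel₀ _ hne]
      _ = _ := by
        conv_lhs => rw [mul_div_assoc]
        nth_rewrite 1 [hpx]
        rw [Finset.sum_mul]
        exact Finset.sum_congr rfl fun m _ => by ring
  rw [torusAverage_congr hsplit, torusAverage_sum fun m _ => hterm m]
  refine Finset.sum_eq_zero fun m hm => ?_
  -- Average first in the variable in which the summand has a positive power left over.
  rcases hdeg m hm with hm | hm
  · rw [torusAverage_swap (hterm m)]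
    refine (circleAverage_congr_sphere (f₂ := fun _ => 0) fun b hb => ?_).trans
      (circleAverage_const 0 0 s)
    have hb0 := ne_zero_of_mem_sphere_abs hs.1 hb
    rw [hs'] at hb
    have hb1 : b ∈ ball (0 : ℂ) 1 := sphere_subset_ball hs.2 hb
    have hzero := circleAverage_pow_mul_div_eval_eq_zero (P := P b) hr
      (differentiableOn_fst_slice hF hb1) (fun a ha => by rw [hP]; exact hpT a ha b hb)
      (hPS b (hsS b hb)) (fun a ha h0 => hF0 (a, b) ⟨ha, hb1⟩ (by rw [← hP]; exact h0))
      (Nat.sub_ne_zero_of_lt hm)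
    refine (circleAverage_congr_sphere (f₂ := fun a => (p.coeff m * b ^ m 1 / b ^ e) •
      (a ^ (m 0 - d) * (F (a, b) / (P b).eval a))) fun a ha => ?_).trans ?_
    · have ha0 := ne_zero_of_mem_sphere_abs hr.1 ha
      simp only [hP, smul_eq_mul, pow_sub₀ a ha0 hm.le]
      field_simp
    · rw [circleAverage_fun_smul, hzero, smul_zero]
  · refine (circleAverage_congr_sphere (f₂ := fun _ => 0) fun a ha => ?_).trans
      (circleAverage_const 0 0 r)
    have ha0 := ne_zero_of_mem_sphere_abs hr.1 ha
    rw [hr'] at ha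
    have ha1 : a ∈ ball (0 : ℂ) 1 := sphere_subset_ball hr.2 ha
    have hzero := circleAverage_pow_mul_div_eval_eq_zero (P := Q a) hs
      (differentiableOn_snd_slice hF ha1) (fun b hb => by rw [hQ]; exact hpT a ha b hb)
      (hQS a (hrS a ha)) (fun b hb h0 => hF0 (a, b) ⟨ha1, hb⟩ (by rw [← hQ]; exact h0))
      (Nat.sub_ne_zero_of_lt hm)
    refine (circleAverage_congr_sphere (f₂ := fun b => (p.coeff m * a ^ m 0 / a ^ d) •
      (b ^ (m 1 - e) * (F (a, b) / (Q a).eval b))) fun b hb => ?_).trans ?_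
    · have hb0 := ne_zero_of_mem_sphere_abs hs.1 hb
      simp only [hQ, smul_eq_mul, pow_sub₀ b hb0 hm.le]
      field_simp
    · rw [circleAverage_fun_smul, hzero, smul_zero]

end vanishing

/-! ### Uniqueness of the extension -/

open Metric Set in
theorem mem_polydisc_two_iff {x : ℂ × ℂ} :
    ![x.1, x.2] ∈ polydisc 2 ↔ x ∈ ball (0 : ℂ) 1 ×ˢ ball (0 : ℂ) 1 := by
  simp [polydisc, Fin.forall_fin_two]

theorem monomial_mem_schurClass (d e : ℕ) :
    (fun z : Fin 2 → ℂ => z 0 ^ d * z 1 ^ e) ∈ schurClass 2 := by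
  refine ⟨fun z _ => ?_, fun z hz => ?_⟩
  · have h (i : Fin 2) : AnalyticAt ℂ (fun z : Fin 2 → ℂ => z i) z :=
      (ContinuousLinearMap.proj (R := ℂ) (φ := fun _ : Fin 2 => ℂ) i).analyticAt z
    exact ((h 0).pow d).mul ((h 1).pow e)
  · rw [norm_mul, norm_pow, norm_pow]
    exact mul_le_one₀ (pow_le_one₀ (norm_nonneg _) (hz 0).le) (by positivity)
      (pow_le_one₀ (norm_nonneg _) (hz 1).le)

theorem theorem3p2 (d₁ d₂ : ℕ) (p : MvPolynomial (Fin 2) ℂ) (hp : Squarefree p)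
    (hV : IsInnerVariety (polyZeroSet p))
    (hdeg : ∀ m ∈ p.support, d₁ < m 0 ∨ d₂ < m 1) :
    IsStrongPickSet (polyZeroSet p) (fun z : Fin 2 → ℂ => z 0 ^ d₁ * z 1 ^ d₂) := by
  refine ⟨hV, monomial_mem_schurClass d₁ d₂, fun h ⟨hana, hle⟩ heq => ?_⟩
  obtain ⟨r, s, hr, hs, hvan⟩ := exists_torus_torusAverage_div_monomial_eq_zero hp hdeg
  set g : ℂ × ℂ → ℂ := fun x => h ![x.1, x.2] with hg
  have hgdiff : DifferentiableOn ℂ g (Metric.ball 0 1 ×ˢ Metric.ball 0 1) := by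
    refine hana.differentiableOn.comp (g := h) (f := fun x : ℂ × ℂ => ![x.1, x.2]) ?_
      fun x hx => mem_polydisc_two_iff.2 hx
    refine (differentiable_pi.2 fun i => ?_).differentiableOn
    fin_cases i
    exacts [differentiable_fst, differentiable_snd]
  have hzero := hvan (fun x => g x - x.1 ^ d₁ * x.2 ^ d₂) (by fun_prop) fun x hx hpx =>
    sub_eq_zero.2 (heq ⟨hpx, mem_polydisc_two_iff.2 hx⟩)
  have hcont := continuousOn_div_monomial hr.1 hs.1
    (hgdiff.continuousOn.mono (sphere_prod_subset_bidisc hr hs)) d₁ d₂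
  have hcoeff : torusAverage (fun x => g x / (x.1 ^ d₁ * x.2 ^ d₂)) r s = 1 := by
    rw [← sub_eq_zero, ← hzero, ← torusAverage_const (r := r) (s := s) 1,
      ← torusAverage_sub hcont continuousOn_const]
    refine torusAverage_congr fun x hx => ?_
    have h1 := pow_ne_zero d₁ (ne_zero_of_mem_sphere_abs hr.1 hx.1)
    have h2 := pow_ne_zero d₂ (ne_zero_of_mem_sphere_abs hs.1 hx.2)
    rw [sub_div, div_self (mul_ne_zero h1 h2)]
  intro z hz
  have hz' : ![z 0, z 1] = z := by ext i; fin_cases i <;> rfl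
  have := eqOn_monomial_of_torusAverage_eq_one hgdiff
    (fun x hx => hle _ (mem_polydisc_two_iff.2 hx)) hr hs hcoeff
    (x := (z 0, z 1)) (by rw [← mem_polydisc_two_iff, hz']; exact hz)
  simpa only [hg, hz'] using this
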